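/- Let $\{0,1\}^n$ index the computational basis of $n$ qubits, and for a permutation $\sigma$ of $\{0,1\}^n$ let $\mathrm{size}(\sigma)=|\{x\in\{0,1\}^n : \sigma(x)\neq x\}|$ be its number of non-fixed points. A quantum circuit on $n$ qubits is a finite sequence of elementary gates acting on these $n$ qubits, where the elementary gates are all single-qubit unitary gates, CNOT gates and three-qubit Toffoli gates, and its size is the total number of gates in the sequence. A circuit implements $\sigma$ if its unitary operator $U$ satisfies $U|x\rangle=|\sigma(x)\rangle$ for every $x\in\{0,1\}^n$. Then there is an absolute constant $c>0$ such that, for every integer $n\ge 2$ and every permutation $\sigma$ of $\{0,1\}^n$, there is a quantum circuit on exactly $n$ qubits (that is, without ancillary qubits) that implements $\sigma$ and has size at most $$c\left(\frac{n\,\mathrm{size}(\sigma)}{\log_2 n}+n\log_2\min\{\mathrm{size}(\sigma),\log_2 n\}\right),$$ where for $\sigma=\mathrm{id}$ the convention $\log_2 0=0$ is used (so that the bound is $0$ and the circuit is empty). -/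

import Mathlib

namespace QCircuit

/-- The computational basis labels `{0,1}^n` (`false` is `0`, `true` is `1`). -/
abbrev Bits (n : ℕ) : Type := Fin n → Bool

/-- Elementary gates on `n` qubits: arbitrary single-qubit unitaries, CNOT gates and
(three-qubit) Toffoli gates. -/
inductive Gate (n : ℕ) : Type
  | single (i : Fin n) (U : Matrix.unitaryGroup Bool ℂ) : Gate n
  | cnot (c t : Fin n) (h : c ≠ t) : Gate n
  | toffoli (c₁ c₂ t : Fin n) (h₁₂ : c₁ ≠ c₂) (h₁ : c₁ ≠ t) (h₂ : c₂ ≠ t) : Gate n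

/-- The matrix, in the computational basis, sending the basis vector `|x⟩` to `|f x⟩`. -/
def basisMap {n : ℕ} (f : Bits n → Bits n) : Matrix (Bits n) (Bits n) ℂ :=
  Matrix.of fun y x => if y = f x then 1 else 0

/-- The operator on `(ℂ²)^{⊗n}` performed by a gate, as a matrix in the computational basis;
the entry at `(y, x)` is `⟨y| g |x⟩`. A single-qubit gate `U` acts as `U` on qubit `i` and as the
identity on the other qubits. -/
def Gate.matrix {n : ℕ} : Gate n → Matrix (Bits n) (Bits n) ℂ
  | .single i U =>
      Matrix.of fun y x =>
        if ∀ j, j ≠ i → y j = x j then (U : Matrix Bool Bool ℂ) (y i) (x i) else 0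
  | .cnot c t _ => basisMap fun x => Function.update x t (xor (x t) (x c))
  | .toffoli c₁ c₂ t _ _ _ => basisMap fun x => Function.update x t (xor (x t) (x c₁ && x c₂))

/-- A quantum circuit on exactly `n` qubits (there are no ancillary qubits): a finite sequence of
elementary gates, the first one in the list being applied first. -/
abbrev Circuit (n : ℕ) : Type := List (Gate n)

/-- The operator performed by a circuit. -/
def Circuit.matrix {n : ℕ} : Circuit n → Matrix (Bits n) (Bits n) ℂ
  | [] => 1
  | g :: C => Circuit.matrix C * g.matrix

/-- The size of a circuit is its total number of elementary gates. -/
def Circuit.size {n : ℕ} (C : Circuit n) : ℕ := List.length C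

/-- The basis state `|x⟩`. -/
def ket {n : ℕ} (x : Bits n) : Bits n → ℂ := Pi.single x 1

/-- The circuit maps `|x⟩` to `|σ x⟩` exactly, for every `x`. -/
def Circuit.Implements {n : ℕ} (C : Circuit n) (σ : Equiv.Perm (Bits n)) : Prop :=
  ∀ x : Bits n, (Circuit.matrix C).mulVec (ket x) = ket (σ x)

/-- The number of non-fixed points of a permutation of `{0,1}^n`. -/
def permSize {n : ℕ} (σ : Equiv.Perm (Bits n)) : ℕ :=
  (Finset.univ.filter fun x : Bits n => σ x ≠ x).card

end QCircuit

/-! The gain over one transposition at a time comes from handling `2 ^ j` of them in one block of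
`O(n)` gates, with `2 ^ j` of order `log n`. Greedily choose a set `S` of `2 ^ j` moved points with
`σ S` disjoint from `S`. Exchanging `x` with `σ x` for every `x ∈ S` cancels `σ` on `S` and moves no
new point, so the number of moved points drops by at least `2 ^ j` (`exists_reduce`).

A block is cheap (`exists_pair_exchange`) because the `2 ^ (j + 1)` points involved, written as rows
of a table, have at most `2 ^ 2 ^ (j + 1) ≤ √n` distinct columns. With `n` CNOT gates all repeated
columns are cleared (`exists_clear_columns`). The points then live on few qubits, where each
transposition costs only as many gates as there are live qubits (`exists_cost_swap`), and they are
moved onto a subcube on which the exchange is one NOT gate controlled by the other qubits being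
zero. Everything else is undone by conjugation.

Without ancillas, a NOT gate with many controls must still cost linearly many gates
(`cost_toggle_all`). Hadamard conjugation turns it into a controlled phase. That phase is halved
recursively, using an increment built from a ripple-carry adder and Toffoli ladders that borrow
qubits in unknown states (`phaseCost_all`).

When too few moved points remain for a block, `j` is lowered by one; each level adds at most three
blocks to the count (`cost_perm`). This yields `O(n (s / 2 ^ j + j))` for `s` moved points, and
`exists_level_bound` chooses `j`. -/

namespace QCircuit

open Matrix

variable {n : ℕ}

/-! ### Circuits as products of operators, and their costs -/

theorem matrix_append (C D : Circuit n) :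
    Circuit.matrix (C ++ D) = Circuit.matrix D * Circuit.matrix C := by
  induction C with
  | nil => simp [Circuit.matrix]
  | cons g C ih => simp [Circuit.matrix, ih, Matrix.mul_assoc]

theorem matrix_singleton (g : Gate n) : Circuit.matrix [g] = g.matrix := by
  simp [Circuit.matrix]

theorem basisMap_apply (f : Bits n → Bits n) (y x : Bits n) :
    basisMap f y x = if y = f x then 1 else 0 := rfl

theorem basisMap_mul (f g : Bits n → Bits n) :
    basisMap f * basisMap g = basisMap (f ∘ g) := by
  ext y x
  simp [Matrix.mul_apply, basisMap_apply]

theorem basisMap_id : basisMap (id : Bits n → Bits n) = 1 := by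
  ext y x
  simp [basisMap_apply, Matrix.one_apply]

/-- Some circuit with at most `k` gates performs the operator `M`. -/
def HasCost (M : Matrix (Bits n) (Bits n) ℂ) (k : ℕ) : Prop :=
  ∃ C : Circuit n, Circuit.matrix C = M ∧ Circuit.size C ≤ k

theorem HasCost.mul {M N : Matrix (Bits n) (Bits n) ℂ} {a b : ℕ}
    (hM : HasCost M a) (hN : HasCost N b) : HasCost (M * N) (a + b) := by
  obtain ⟨C, rfl, hC⟩ := hM
  obtain ⟨D, rfl, hD⟩ := hN
  refine ⟨D ++ C, matrix_append D C, ?_⟩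
  simp only [Circuit.size, List.length_append] at *
  omega

theorem HasCost.mono {M : Matrix (Bits n) (Bits n) ℂ} {a b : ℕ}
    (hM : HasCost M a) (h : a ≤ b) : HasCost M b := by
  obtain ⟨C, hC, hs⟩ := hM
  exact ⟨C, hC, hs.trans h⟩

theorem hasCost_one (k : ℕ) : HasCost (1 : Matrix (Bits n) (Bits n) ℂ) k :=
  ⟨[], rfl, by simp [Circuit.size]⟩

theorem hasCost_gate (g : Gate n) : HasCost g.matrix 1 :=
  ⟨[g], matrix_singleton g, by simp [Circuit.size]⟩

/-! ### Controlled operators on one qubit -/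

/-- The operator acting on qubit `t` by a `2 × 2` matrix that may depend on the other qubits. -/
def ctrl (t : Fin n) (V : Bits n → Matrix Bool Bool ℂ) : Matrix (Bits n) (Bits n) ℂ :=
  Matrix.of fun y x => if ∀ j, j ≠ t → y j = x j then V x (y t) (x t) else 0

theorem eq_update_of_forall_ne {t : Fin n} {y x : Bits n} (h : ∀ j, j ≠ t → y j = x j) :
    y = Function.update x t (y t) := by
  ext j
  by_cases hj : j = t
  · subst hj; simp
  · simp [hj, h j hj]

/-- The intermediate state differs from `x` in bit `t` only, so `V` must not depend on that bit for
its value there to be `V x`. -/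
theorem ctrl_mul (t : Fin n) (V W : Bits n → Matrix Bool Bool ℂ)
    (hV : ∀ x b, V (Function.update x t b) = V x) :
    ctrl t V * ctrl t W = ctrl t fun x => V x * W x := by
  ext y x
  simp only [Matrix.mul_apply, ctrl, Matrix.of_apply]
  by_cases h : ∀ j, j ≠ t → y j = x j
  · rw [if_pos h]
    have hinj : Function.Injective fun b : Bool => Function.update x t b := by
      intro a b hab
      simpa using congrFun hab t
    rw [← Finset.sum_subset (Finset.subset_univ (Finset.univ.image fun b : Bool =>
      Function.update x t b)), Finset.sum_image (fun a _ b _ hab => hinj hab)]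
    · refine Finset.sum_congr rfl fun b _ => ?_
      rw [if_pos, if_pos, hV]
      · simp
      · intro j hj; simp [hj]
      · intro j hj; simp [hj, h j hj]
    · intro z _ hz
      have : ¬ ∀ j, j ≠ t → z j = x j := by
        intro hzx
        exact hz (Finset.mem_image.2 ⟨z t, Finset.mem_univ _, (eq_update_of_forall_ne hzx).symm⟩)
      rw [if_neg this, mul_zero]
  · rw [if_neg h]
    refine Finset.sum_eq_zero fun z _ => ?_
    by_cases h1 : ∀ j, j ≠ t → y j = z j
    · have h2 : ¬ ∀ j, j ≠ t → z j = x j := fun h2 => h fun j hj => (h1 j hj).trans (h2 j hj)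
      rw [if_neg h2, mul_zero]
    · rw [if_neg h1, zero_mul]

theorem single_matrix (t : Fin n) (U : Matrix.unitaryGroup Bool ℂ) :
    (Gate.single t U).matrix = ctrl t fun _ => (U : Matrix Bool Bool ℂ) := rfl

theorem ctrl_one (t : Fin n) : ctrl t (fun _ => 1) = 1 := by
  ext y x
  simp only [ctrl, Matrix.of_apply, Matrix.one_apply]
  by_cases h : y = x
  · subst h; simp
  · rw [if_neg h]
    by_cases h1 : ∀ j, j ≠ t → y j = x j
    · rw [if_pos h1, if_neg]
      intro h2
      apply h
      rw [eq_update_of_forall_ne h1, h2]; simp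
    · rw [if_neg h1]

/-- Add the Boolean value `f x` to bit `t`. -/
def toggle (t : Fin n) (f : Bits n → Bool) : Bits n → Bits n :=
  fun x => Function.update x t (xor (x t) (f x))

theorem toggle_same (t : Fin n) (f : Bits n → Bool) (x : Bits n) :
    toggle t f x t = xor (x t) (f x) := by simp [toggle]

theorem toggle_ne {t q : Fin n} (h : q ≠ t) (f : Bits n → Bool) (x : Bits n) :
    toggle t f x q = x q := by simp [toggle, h]

theorem toggle_apply (t q : Fin n) (f : Bits n → Bool) (x : Bits n) :
    toggle t f x q = if q = t then xor (x t) (f x) else x q := by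
  by_cases h : q = t
  · subst h; simp [toggle]
  · simp [toggle, h]

theorem toggle_toggle (t : Fin n) (f : Bits n → Bool)
    (hf : ∀ x b, f (Function.update x t b) = f x) : toggle t f ∘ toggle t f = id := by
  funext x
  simp [toggle, hf]

/-! ### Inverse circuits -/

theorem exists_gate_inv (g : Gate n) : ∃ g' : Gate n, g'.matrix * g.matrix = 1 := by
  cases g with
  | single i U =>
    refine ⟨.single i U⁻¹, ?_⟩
    rw [single_matrix, single_matrix, ctrl_mul _ _ _ (fun _ _ => rfl), ← ctrl_one i]
    congr 1
    funext _
    rw [← Matrix.UnitaryGroup.mul_val, inv_mul_cancel, Matrix.UnitaryGroup.one_val]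
  | cnot c t h =>
    refine ⟨.cnot c t h, ?_⟩
    rw [Gate.matrix, basisMap_mul, ← basisMap_id]
    congr 1
    exact toggle_toggle t (fun x => x c) fun x b => by simp [h]
  | toffoli c₁ c₂ t h₁₂ h₁ h₂ =>
    refine ⟨.toffoli c₁ c₂ t h₁₂ h₁ h₂, ?_⟩
    rw [Gate.matrix, basisMap_mul, ← basisMap_id]
    congr 1
    exact toggle_toggle t (fun x => x c₁ && x c₂) fun x b => by simp [h₁, h₂]

theorem exists_circuit_inv (C : Circuit n) :
    ∃ D : Circuit n, Circuit.matrix D * Circuit.matrix C = 1 ∧ Circuit.size D = Circuit.size C := by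
  induction C with
  | nil => exact ⟨[], by simp [Circuit.matrix], rfl⟩
  | cons g C ih =>
    obtain ⟨D, hD, hs⟩ := ih
    obtain ⟨g', hg⟩ := exists_gate_inv g
    refine ⟨D ++ [g'], ?_, by simp_all [Circuit.size]⟩
    rw [matrix_append, matrix_singleton]
    calc g'.matrix * Circuit.matrix D * (Circuit.matrix C * g.matrix)
        = g'.matrix * (Circuit.matrix D * Circuit.matrix C) * g.matrix := by
          simp only [Matrix.mul_assoc]
      _ = 1 := by rw [hD, mul_one, hg]

theorem HasCost.exists_inv {M : Matrix (Bits n) (Bits n) ℂ} {k : ℕ} (h : HasCost M k) :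
    ∃ N, N * M = 1 ∧ HasCost N k := by
  obtain ⟨C, rfl, hC⟩ := h
  obtain ⟨D, hD, hs⟩ := exists_circuit_inv C
  exact ⟨_, hD, D, rfl, hs ▸ hC⟩

/-! ### Cost of maps on basis states -/

/-- Some circuit with at most `k` gates maps `|x⟩` to `|f x⟩` for all `x`. -/
def Cost (f : Bits n → Bits n) (k : ℕ) : Prop := HasCost (basisMap f) k

theorem Cost.mono {f : Bits n → Bits n} {a b : ℕ} (hf : Cost f a) (h : a ≤ b) : Cost f b :=
  HasCost.mono hf h

theorem Cost.comp {f g : Bits n → Bits n} {a b : ℕ} (hf : Cost f a) (hg : Cost g b) :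
    Cost (f ∘ g) (a + b) := by
  rw [Cost, ← basisMap_mul]
  exact HasCost.mul hf hg

theorem cost_id (k : ℕ) : Cost (id : Bits n → Bits n) k := by
  rw [Cost, basisMap_id]
  exact hasCost_one k

/-- Circuits are invertible, so any map they realise is a permutation; conjugations by such maps
then come with no separate proof of bijectivity. -/
theorem Cost.bijective {f : Bits n → Bits n} {k : ℕ} (hf : Cost f k) : Function.Bijective f := by
  obtain ⟨N, hN, -⟩ := hf.exists_inv
  rw [← Finite.injective_iff_bijective]
  intro x y hxy
  have h : ∀ z, (N * basisMap f) x z = N x (f z) := by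
    intro z
    simp [Matrix.mul_apply, basisMap_apply]
  have h1 := h x
  have h2 := h y
  rw [hN] at h1 h2
  rw [← hxy, ← h1] at h2
  by_contra hne
  simp [hne] at h2

theorem Cost.exists_perm {f : Bits n → Bits n} {k : ℕ} (hf : Cost f k) :
    ∃ σ : Equiv.Perm (Bits n), ⇑σ = f :=
  ⟨Equiv.ofBijective f hf.bijective, rfl⟩

theorem Cost.inv {σ : Equiv.Perm (Bits n)} {k : ℕ} (hσ : Cost σ k) : Cost (σ⁻¹ : Equiv.Perm _) k := by
  obtain ⟨N, hN, hk⟩ := hσ.exists_inv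
  have : basisMap (σ⁻¹ : Equiv.Perm _) = N := by
    calc basisMap (σ⁻¹ : Equiv.Perm _) = N * basisMap σ * basisMap (σ⁻¹ : Equiv.Perm _) := by
          rw [hN, one_mul]
      _ = N := by
          rw [Matrix.mul_assoc, basisMap_mul, ← Equiv.Perm.coe_mul, mul_inv_cancel,
            Equiv.Perm.coe_one, basisMap_id, mul_one]
  rw [Cost, this]
  exact hk

theorem cost_cnot {c t : Fin n} (h : c ≠ t) : Cost (toggle t fun x => x c) 1 :=
  hasCost_gate (.cnot c t h)

theorem cost_toffoli {c₁ c₂ t : Fin n} (h₁₂ : c₁ ≠ c₂) (h₁ : c₁ ≠ t) (h₂ : c₂ ≠ t) :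
    Cost (toggle t fun x => x c₁ && x c₂) 1 :=
  hasCost_gate (.toffoli c₁ c₂ t h₁₂ h₁ h₂)

theorem basisMap_toggle (t : Fin n) (f : Bits n → Bool) :
    basisMap (toggle t f) = ctrl t fun x => Matrix.of fun a b => if a = xor b (f x) then 1 else 0 := by
  ext y x
  simp only [basisMap_apply, ctrl, Matrix.of_apply]
  by_cases h : ∀ j, j ≠ t → y j = x j
  · rw [if_pos h]
    congr 1
    rw [eq_iff_iff]
    constructor
    · intro h1; rw [h1, toggle_same]
    · intro h1; rw [eq_update_of_forall_ne h, h1, toggle]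
  · rw [if_neg h, if_neg]
    intro h1
    exact h fun j hj => by rw [h1, toggle_ne hj]

/-! ### Single-qubit gates and diagonal phases -/

/-- The Pauli `X` matrix. -/
def pauliX : Matrix.unitaryGroup Bool ℂ :=
  ⟨Matrix.of fun a b => if a = !b then 1 else 0, by
    rw [Matrix.mem_unitaryGroup_iff]
    ext a b
    cases a <;> cases b <;> simp [Matrix.mul_apply, Matrix.star_apply]⟩

/-- The Hadamard matrix. -/
noncomputable def hadamard : Matrix.unitaryGroup Bool ℂ :=
  ⟨Matrix.of fun a b => if a && b then -(((√2 : ℝ) : ℂ)⁻¹) else ((√2 : ℝ) : ℂ)⁻¹, by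
    have h : ((√2 : ℝ) : ℂ)⁻¹ * ((√2 : ℝ) : ℂ)⁻¹ = 1 / 2 := by
      rw [← mul_inv, ← Complex.ofReal_mul, Real.mul_self_sqrt (by norm_num)]
      norm_num
    rw [Matrix.mem_unitaryGroup_iff]
    ext a b
    cases a <;> cases b <;> simp [Matrix.mul_apply, Matrix.star_apply, h] <;> norm_num⟩

/-- The diagonal matrix with entries `1` and `e ^ (i α)`. -/
noncomputable def phaseGate (α : ℝ) : Matrix.unitaryGroup Bool ℂ :=
  ⟨Matrix.diagonal fun a => Complex.exp ((if a then α else 0 : ℝ) * Complex.I), by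
    rw [Matrix.mem_unitaryGroup_iff, Matrix.star_eq_conjTranspose, Matrix.diagonal_conjTranspose,
      Matrix.diagonal_mul_diagonal, ← Matrix.diagonal_one]
    congr 1
    funext a
    simp only [Pi.star_apply, RCLike.star_def, ← Complex.exp_conj, ← Complex.exp_add]
    simp⟩

theorem cost_not (t : Fin n) : Cost (toggle t fun _ => true) 1 := by
  have h := hasCost_gate (.single t pauliX)
  rw [single_matrix] at h
  rw [Cost, basisMap_toggle]
  simpa [pauliX] using h

/-- Some circuit with at most `k` gates multiplies `|x⟩` by `e ^ (i φ x)` for all `x`. -/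
def PhaseCost (φ : Bits n → ℝ) (k : ℕ) : Prop :=
  HasCost (Matrix.diagonal fun x => Complex.exp (φ x * Complex.I)) k

theorem PhaseCost.mono {φ : Bits n → ℝ} {a b : ℕ} (hf : PhaseCost φ a) (h : a ≤ b) :
    PhaseCost φ b :=
  HasCost.mono hf h

theorem PhaseCost.add {φ ψ : Bits n → ℝ} {a b : ℕ} (hφ : PhaseCost φ a) (hψ : PhaseCost ψ b) :
    PhaseCost (fun x => φ x + ψ x) (a + b) := by
  have := HasCost.mul hφ hψ
  rw [Matrix.diagonal_mul_diagonal] at this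
  simpa [PhaseCost, ← Complex.exp_add, add_mul] using this

theorem phaseCost_zero (k : ℕ) : PhaseCost (fun _ : Bits n => 0) k := by
  simpa [PhaseCost] using hasCost_one (n := n) k

/-- Conjugating a diagonal operator by a permutation of the basis relabels its diagonal; `f` is
computed and then uncomputed, hence `2 * b`. -/
theorem PhaseCost.comp {φ : Bits n → ℝ} {f : Bits n → Bits n} {a b : ℕ} (hφ : PhaseCost φ a)
    (hf : Cost f b) : PhaseCost (fun x => φ (f x)) (a + 2 * b) := by
  obtain ⟨N, hN, hk⟩ := hf.exists_inv
  have h1 : (Matrix.diagonal fun x => Complex.exp (φ x * Complex.I)) * basisMap f =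
      basisMap f * (Matrix.diagonal fun x => Complex.exp (φ (f x) * Complex.I)) := by
    ext y x
    simp only [Matrix.diagonal_mul, Matrix.mul_diagonal, basisMap_apply]
    by_cases h : y = f x
    · subst h; simp
    · simp [h]
  have h2 := hk.mul (HasCost.mul hφ hf)
  rw [h1, ← Matrix.mul_assoc, hN, one_mul] at h2
  exact h2.mono (by omega)

theorem diagonal_eq_ctrl (t : Fin n) (φ : Bits n → ℂ) :
    Matrix.diagonal φ = ctrl t fun x => Matrix.diagonal fun b => φ (Function.update x t b) := by
  ext y x
  simp only [ctrl, Matrix.of_apply, Matrix.diagonal_apply]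
  by_cases h : y = x
  · subst h; simp
  · rw [if_neg h]
    by_cases h1 : ∀ j, j ≠ t → y j = x j
    · rw [if_pos h1, if_neg]
      intro h2
      apply h
      rw [eq_update_of_forall_ne h1, h2]; simp
    · rw [if_neg h1]

theorem phaseCost_bit (t : Fin n) (α : ℝ) : PhaseCost (fun x => if x t then α else 0) 1 := by
  have h := hasCost_gate (.single t (phaseGate α))
  rw [single_matrix] at h
  rw [PhaseCost, diagonal_eq_ctrl t]
  simpa [phaseGate] using h

/-- Conjugating a controlled phase flip by Hadamard gates gives a controlled bit flip. -/
theorem cost_toggle_of_phaseCost {t : Fin n} {f : Bits n → Bool} {k : ℕ}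
    (hf : ∀ x b, f (Function.update x t b) = f x)
    (h : PhaseCost (fun x => if x t && f x then Real.pi else 0) k) : Cost (toggle t f) (k + 2) := by
  have hH := hasCost_gate (.single t hadamard)
  rw [single_matrix] at hH
  rw [PhaseCost, diagonal_eq_ctrl t] at h
  have h1 := hH.mul (h.mul hH)
  rw [ctrl_mul, ctrl_mul] at h1
  · rw [Cost, basisMap_toggle]
    refine (HasCost.mono ?_ (show 1 + (k + 1) ≤ k + 2 by omega))
    convert h1 using 3 with x
    have h : ((√2 : ℝ) : ℂ)⁻¹ * ((√2 : ℝ) : ℂ)⁻¹ = 1 / 2 := by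
      rw [← mul_inv, ← Complex.ofReal_mul, Real.mul_self_sqrt (by norm_num)]
      norm_num
    ext a b
    simp only [hf, Function.update_self]
    cases hfx : f x <;> cases a <;> cases b <;>
      simp [hadamard, Matrix.mul_apply, h] <;> norm_num
  all_goals
    intro x b
    simp

/-! ### Parallel flips and CNOT gates -/

/-- Flip the bits in `D`. -/
def flipOn (D : Finset (Fin n)) : Bits n → Bits n := fun x q => if q ∈ D then !x q else x q

/-- Add the bit `r q` to each bit `q ∈ D`. -/
def fanout (D : Finset (Fin n)) (r : Fin n → Fin n) : Bits n → Bits n :=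
  fun x q => if q ∈ D then xor (x q) (x (r q)) else x q

theorem cost_flipOn (D : Finset (Fin n)) : Cost (flipOn D) D.card := by
  induction D using Finset.induction_on with
  | empty => exact cost_id 0
  | insert t D ht ih =>
    have h := (cost_not t).comp ih
    rw [Finset.card_insert_of_notMem ht]
    convert h.mono (show _ ≤ D.card + 1 by omega) using 1
    funext x q
    by_cases hq : q = t
    · subst hq; simp [flipOn, toggle, ht]
    · simp [flipOn, toggle, hq]

theorem cost_fanout (D : Finset (Fin n)) (r : Fin n → Fin n) (hr : ∀ q ∈ D, r q ∉ D) :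
    Cost (fanout D r) D.card := by
  suffices H : ∀ S ⊆ D, Cost (fanout S r) S.card from H D subset_rfl
  intro S
  induction S using Finset.induction_on with
  | empty => exact fun _ => cost_id 0
  | insert t S ht ih =>
    intro hS
    have htD : t ∈ D := hS (Finset.mem_insert_self t S)
    have hrt : r t ≠ t := fun h => hr t htD (h.symm ▸ htD)
    have h := (cost_cnot hrt).comp (ih fun q hq => hS (Finset.mem_insert_of_mem hq))
    rw [Finset.card_insert_of_notMem ht]
    have hrS : r t ∉ S := fun h => hr t htD (hS (Finset.mem_insert_of_mem h))
    convert h.mono (show _ ≤ S.card + 1 by omega) using 1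
    funext x q
    by_cases hq : q = t
    · subst hq; simp [fanout, toggle, ht, hrS]
    · simp [fanout, toggle, hq]

/-! ### Toffoli ladders with borrowed qubits -/

theorem all_congr {qs : List (Fin n)} {x y : Bits n} (h : ∀ q ∈ qs, x q = y q) :
    qs.all x = qs.all y := by
  induction qs with
  | nil => rfl
  | cons q qs ih =>
    simp only [List.all_cons]
    rw [h q (by simp), ih fun p hp => h p (by simp [hp])]

/-- A ladder of Toffoli gates adds the conjunction of the bits `qs` to the bit `t`, and changes
besides only the bits `ds`. -/
theorem exists_ladder (qs ds : List (Fin n)) (t : Fin n) (hne : qs ≠ [])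
    (hlen : qs.length ≤ ds.length + 1) (hnd : (t :: (qs ++ ds)).Nodup) :
    ∃ ρ : Bits n → Bits n, Cost ρ (2 * qs.length) ∧ ρ ∘ ρ = id ∧
      (∀ x p, p ∉ t :: ds → ρ x p = x p) ∧ (∀ x, ρ x t = xor (x t) (qs.all x)) ∧
      (∀ x p b, p ∉ t :: (qs ++ ds) → ρ (Function.update x p b) = Function.update (ρ x) p b) ∧
      Cost (toggle t qs.all) (4 * qs.length) := by
  induction qs generalizing ds t with
  | nil => exact absurd rfl hne
  | cons q qs ih =>
    cases qs with
    | nil =>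
      have hqt : q ≠ t := by
        rintro rfl
        simp at hnd
      have hall : toggle t ([q].all) = toggle t fun x => x q := by
        funext x
        simp [toggle]
      refine ⟨toggle t fun x => x q, (cost_cnot hqt).mono (by simp), ?_, ?_, ?_, ?_, ?_⟩
      · exact toggle_toggle t _ fun x b => by simp [hqt]
      · intro x p hp
        exact toggle_ne (fun h => hp (by simp [h])) _ _
      · intro x
        simp [toggle]
      · intro x p b hp
        simp only [List.cons_append, List.nil_append, List.mem_cons, not_or] at hp
        simp only [toggle]
        rw [Function.update_of_ne (Ne.symm hp.2.1), Function.update_of_ne (Ne.symm hp.1),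
          Function.update_comm hp.1]
      · rw [hall]
        exact (cost_cnot hqt).mono (by simp)
    | cons q' qs =>
      cases ds with
      | nil => simp at hlen
      | cons d ds =>
        have hnd' : (d :: ((q' :: qs) ++ ds)).Nodup := by
          simp only [List.nodup_cons, List.nodup_append, List.mem_append, List.mem_cons,
            List.cons_append] at hnd ⊢
          grind
        obtain ⟨ρ, hρ, hinv, hfix, ht, hupd, -⟩ := ih ds d (by simp)
          (by simpa using hlen) hnd'
        have htd : t ∉ d :: ((q' :: qs) ++ ds) := by
          simp only [List.nodup_cons, List.mem_append, List.mem_cons, List.cons_append] at hnd ⊢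
          grind
        have hqd : q ∉ d :: ds := by
          simp only [List.nodup_cons, List.mem_append, List.mem_cons, List.cons_append] at hnd ⊢
          grind
        have hqt : q ≠ t := by
          rintro rfl
          simp at hnd
        have hqd' : q ≠ d := fun h => hqd (by simp [h])
        have hdt : d ≠ t := fun h => htd (by simp [h])
        set T : Bits n → Bits n := toggle t fun x => x q && x d with hT
        have hcT : Cost T 1 := cost_toffoli hqd' hqt hdt
        have hTT : T ∘ T = id := toggle_toggle t _ fun x b => by simp [hqt, hdt]
        -- The two `T` gates add `x q && d` to `t` before and after `ρ` changes `d` by the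
        -- conjunction of the remaining controls. The unknown value of `d` cancels, leaving `x q`
        -- times that conjunction.
        have key : ∀ x, T (ρ (T x)) =
            Function.update (ρ x) t (xor (x t) (x q && (q' :: qs).all x)) := by
          intro x
          have h1 : T x = Function.update x t (xor (x t) (x q && x d)) := rfl
          rw [h1, hupd _ _ _ htd]
          simp only [hT, toggle]
          rw [Function.update_self, Function.update_idem, Function.update_of_ne hqt,
            Function.update_of_ne hdt, hfix x q hqd, ht]
          congr 1
          generalize (q' :: qs).all x = a
          cases x t <;> cases x q <;> cases x d <;> cases a <;> rfl
        refine ⟨T ∘ ρ ∘ T, ?_, ?_, ?_, ?_, ?_, ?_⟩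
        · exact (hcT.comp (hρ.comp hcT)).mono (by simp only [List.length_cons]; omega)
        · funext x
          have e1 := fun y => congrFun hTT y
          have e2 := fun y => congrFun hinv y
          simp only [Function.comp_apply, id] at e1 e2 ⊢
          rw [e1, e2, e1]
        · intro x p hp
          simp only [Function.comp_apply]
          rw [key, Function.update_of_ne (by grind), hfix x p (by grind)]
        · intro x
          simp only [Function.comp_apply]
          rw [key, Function.update_self, List.all_cons (a := q)]
        · intro x p b hp
          simp only [Function.comp_apply]
          have hpt : p ≠ t := by grind
          rw [key, key, hupd _ _ _ (by grind), Function.update_comm hpt,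
            Function.update_of_ne (Ne.symm hpt), Function.update_of_ne (by grind)]
          congr 4
          exact all_congr fun r hr => Function.update_of_ne (by grind) _ _
        -- A prior run of the involution `ρ` makes the inner `ρ` restore the borrowed bits.
        · have : toggle t (q :: q' :: qs).all = (T ∘ ρ ∘ T) ∘ ρ := by
            funext x
            simp only [Function.comp_apply]
            rw [key, hfix x t (by grind), hfix x q hqd]
            have e2 := congrFun hinv x
            simp only [Function.comp_apply, id] at e2
            rw [e2, toggle, List.all_cons]
            congr 3
            refine all_congr fun r hr => (hfix _ _ ?_).symm
            simp only [List.nodup_cons, List.nodup_append, List.mem_append, List.mem_cons,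
              List.cons_append] at hnd hr ⊢
            grind
          rw [this]
          exact ((hcT.comp (hρ.comp hcT)).comp hρ).mono
            (by simp only [List.length_cons]; omega)

theorem cost_toggle_all_of_dirty (qs ds : List (Fin n)) (t : Fin n)
    (hlen : qs.length ≤ ds.length + 1) (hnd : (t :: (qs ++ ds)).Nodup) :
    Cost (toggle t qs.all) (4 * qs.length + 1) := by
  cases qs with
  | nil => exact cost_not t
  | cons q qs =>
    obtain ⟨ρ, -, -, -, -, -, h⟩ := exists_ladder (q :: qs) ds t (by simp) hlen hnd
    exact h.mono (by omega)

/-! ### Adder and increment -/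

/-- The number whose binary digits, from the lowest to the highest, are the bits `qs`. -/
def val : List (Fin n) → Bits n → ℕ
  | [], _ => 0
  | q :: qs, x => (x q).toNat + 2 * val qs x

theorem val_congr {qs : List (Fin n)} {x y : Bits n} (h : ∀ q ∈ qs, x q = y q) :
    val qs x = val qs y := by
  induction qs with
  | nil => rfl
  | cons q qs ih =>
    simp only [val]
    rw [h q (by simp), ih fun p hp => h p (by simp [hp])]

theorem val_lt (qs : List (Fin n)) (x : Bits n) : val qs x < 2 ^ qs.length := by
  induction qs with
  | nil => simp [val]
  | cons q qs ih =>
    have := Bool.toNat_le (x q)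
    simp only [val, List.length_cons, pow_succ]
    omega

theorem val_flip {qs : List (Fin n)} {x y : Bits n} (h : ∀ q ∈ qs, y q = !x q) :
    val qs x + val qs y + 1 = 2 ^ qs.length := by
  induction qs with
  | nil => simp [val]
  | cons q qs ih =>
    have h1 := ih fun p hp => h p (by simp [hp])
    have h2 := h q (by simp)
    simp only [val, List.length_cons, pow_succ, h2]
    cases x q <;> simp <;> omega

theorem all_iff_val (qs : List (Fin n)) (x : Bits n) :
    qs.all x = true ↔ val qs x + 1 = 2 ^ qs.length := by
  induction qs with
  | nil => simp [val]
  | cons q qs ih =>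
    have := val_lt qs x
    simp only [val, List.length_cons, pow_succ, List.all_cons, Bool.and_eq_true, ih]
    cases x q <;> simp <;> omega

/-- In-place ripple-carry addition: the carry into each position is held by the preceding summand
bit (at first by `c`), and all carries are uncomputed on the way back. -/
theorem exists_adder (vs ys : List (Fin n)) (c : Fin n) (hlen : vs.length = ys.length)
    (hnd : (c :: (vs ++ ys)).Nodup) :
    ∃ f : Bits n → Bits n, Cost f (6 * ys.length) ∧ (∀ x q, q ∉ ys → f x q = x q) ∧
      ∀ x, val ys (f x) = (val ys x + val vs x + (x c).toNat) % 2 ^ ys.length := by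
  induction ys generalizing vs c with
  | nil =>
    exact ⟨id, cost_id _, fun _ _ _ => rfl, fun x => by simp [val, Nat.mod_one]⟩
  | cons y ys ih =>
    cases vs with
    | nil => simp at hlen
    | cons v vs =>
      have hnd' : (v :: (vs ++ ys)).Nodup := by
        simp only [List.nodup_cons, List.nodup_append, List.mem_append, List.mem_cons,
          List.cons_append] at hnd ⊢
        grind
      have hne : c ≠ v ∧ c ≠ y ∧ v ≠ y ∧ c ∉ vs ∧ c ∉ ys ∧ v ∉ vs ∧ v ∉ ys ∧ y ∉ vs ∧ y ∉ ys := by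
        simp only [List.nodup_cons, List.nodup_append, List.mem_append, List.mem_cons,
          List.cons_append] at hnd
        grind
      obtain ⟨hcv, hcy, hvy, hcvs, hcys, hvvs, hvys, hyvs, hyys⟩ := hne
      obtain ⟨g, hg, hfix, hval⟩ := ih vs v (by simpa using hlen) hnd'
      set Tv : Bits n → Bits n := toggle v fun x => x y && x c with hTv
      set Tc : Bits n → Bits n := toggle c fun x => x v with hTc
      set Ty : Bits n → Bits n := toggle y fun x => x v with hTy
      set Uy : Bits n → Bits n := toggle y fun x => x c with hUy
      have kv : Cost Tv 1 := cost_toffoli hcy.symm hvy.symm hcv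
      have kc : Cost Tc 1 := cost_cnot hcv.symm
      have ky : Cost Ty 1 := cost_cnot hvy
      have ku : Cost Uy 1 := cost_cnot hcy
      -- `Tv ∘ Tc ∘ Ty` writes the majority of `y`, `v`, `c`, the next carry, into `v`. After the
      -- recursive call, `Tc ∘ Tv` restores `v` and `c`, and `Uy` completes the sum bit.
      refine ⟨Uy ∘ Tc ∘ Tv ∘ g ∘ Tv ∘ Tc ∘ Ty, ?_, ?_, ?_⟩
      · exact (ku.comp (kc.comp (kv.comp (hg.comp (kv.comp (kc.comp ky)))))).mono
          (by simp only [List.length_cons]; omega)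
      all_goals
        intro x
        set x1 : Bits n := Tv (Tc (Ty x)) with hx1
        have e1y : x1 y = xor (x y) (x v) := by
          simp [hx1, hTv, hTc, hTy, toggle_apply, hvy.symm, hcy.symm]
        have e1c : x1 c = xor (x c) (x v) := by
          simp [hx1, hTv, hTc, hTy, toggle_apply, hvy, hcy, hcv]
        have e1v : x1 v = xor (x v) ((xor (x y) (x v)) && (xor (x c) (x v))) := by
          simp [hx1, hTv, hTc, hTy, toggle_apply, hvy, hcy, hcy.symm, hcv.symm]
        have e1 : ∀ q, q ≠ c → q ≠ v → q ≠ y → x1 q = x q := by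
          intro q h1 h2 h3
          simp [hx1, hTv, hTc, hTy, toggle_apply, h1, h2, h3]
        have e2 : ∀ q, q ∉ ys → g x1 q = x1 q := fun q hq => hfix x1 q hq
      · intro q hq
        have hqy : q ≠ y := by grind
        have hqys : q ∉ ys := by grind
        simp only [Function.comp_apply, ← hx1]
        simp only [hUy, toggle_ne hqy, hTc, hTv, toggle_apply, e2 q hqys, e2 y hyys, e2 c hcys,
          e2 v hvys, e1y, e1c, e1v]
        by_cases hqc : q = c
        · subst hqc
          simp only [hcv, if_true, if_false, e1c]
          cases x q <;> cases x v <;> cases x y <;> rfl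
        · by_cases hqv : q = v
          · subst hqv
            simp only [hqc, if_true, if_false, e1v]
            cases x q <;> cases x c <;> cases x y <;> rfl
          · simp only [hqc, hqv, if_false]
            exact e1 q hqc hqv hqy
      · simp only [Function.comp_apply, ← hx1]
        simp only [val]
        have hy : Uy (Tc (Tv (g x1))) y = xor (xor (x y) (x v)) (x c) := by
          simp only [hUy, hTc, hTv, toggle_apply, e2 y hyys, e2 c hcys, e2 v hvys, e1y, e1c, e1v,
            hcv, hcy.symm, hvy.symm, if_true, if_false]
          cases x c <;> cases x v <;> cases x y <;> rfl
        have hys : val ys (Uy (Tc (Tv (g x1)))) = val ys (g x1) := by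
          refine val_congr fun q hq => ?_
          rw [hUy, toggle_ne (by grind), hTc, toggle_ne (by grind), hTv, toggle_ne (by grind)]
        have h3 : val ys x1 = val ys x :=
          val_congr fun q hq => e1 q (by grind) (by grind) (by grind)
        have h4 : val vs x1 = val vs x :=
          val_congr fun q hq => e1 q (by grind) (by grind) (by grind)
        rw [hy, hys, hval, h3, h4, e1v, List.length_cons, pow_succ, mul_comm (2 ^ ys.length) 2]
        generalize val ys x = Y
        generalize val vs x = V
        generalize 2 ^ ys.length = N
        have hmod : ∀ b s : ℕ, b < 2 → b + 2 * (s % N) = (b + 2 * s) % (2 * N) := by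
          intro b s hb
          rw [Nat.add_mod, Nat.mul_mod_mul_left]
          rcases Nat.eq_zero_or_pos N with rfl | hN
          · simp
          · have h1 : s % N < N := Nat.mod_lt _ hN
            rw [Nat.mod_eq_of_lt (show b < 2 * N by omega),
              Nat.mod_eq_of_lt (show b + 2 * (s % N) < 2 * N by omega)]
        rw [hmod _ _ (Bool.toNat_lt _)]
        congr 1
        cases x c <;> cases x v <;> cases x y <;> simp <;> ring

theorem cost_flip_unless (ys : List (Fin n)) (c : Fin n) (hc : c ∉ ys) :
    Cost (fun x q => if q ∈ ys then xor (x q) (!x c) else x q : Bits n → Bits n)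
      (ys.length + 2) := by
  have h1 := cost_fanout ys.toFinset (fun _ => c) fun q _ => by simpa using hc
  have h := (cost_not c).comp (h1.comp (cost_not c))
  have hlen := ys.toFinset_card_le
  convert h.mono (show _ ≤ ys.length + 2 by omega) using 1
  funext x q
  simp only [Function.comp_apply, fanout, toggle_apply, List.mem_toFinset]
  by_cases hq : q = c
  · subst hq; simp [hc]
  · simp [hq]

/-- Adding the bit `xs.all x` to the number held by `ys`, with one further qubit `c` that is left
unchanged. -/
theorem exists_increment (xs ys : List (Fin n)) (c : Fin n) (h1 : ys.length ≤ xs.length)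
    (h2 : xs.length ≤ ys.length + 1) (hnd : (c :: (xs ++ ys)).Nodup) :
    ∃ f : Bits n → Bits n, Cost f (24 * ys.length + 16) ∧ (∀ x q, q ∉ ys → f x q = x q) ∧
      ∀ x, val ys (f x) = (val ys x + (xs.all x).toNat) % 2 ^ ys.length := by
  -- The same qubits serve as controls and as a summand of unknown value; conversely `ys` is
  -- borrowed by the ladder that computes `xs.all`.
  set vs := xs.take ys.length with hvs
  have hvlen : vs.length = ys.length := by simp [hvs, h1]
  have hvx : ∀ q ∈ vs, q ∈ xs := fun q hq => List.mem_of_mem_take hq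
  have hdisj : ∀ q ∈ xs, q ∉ ys := by
    simp only [List.nodup_cons, List.nodup_append] at hnd
    grind
  have hcx : c ∉ xs := by
    simp only [List.nodup_cons, List.mem_append] at hnd
    grind
  have hcy : c ∉ ys := by
    simp only [List.nodup_cons, List.mem_append] at hnd
    grind
  have hndx : xs.Nodup := by
    simp only [List.nodup_cons, List.nodup_append] at hnd
    grind
  have hndv : (c :: (vs ++ ys)).Nodup := by
    have : vs.Nodup := hndx.sublist (List.take_sublist _ _)
    simp only [List.nodup_cons, List.nodup_append, List.mem_append]
    grind
  obtain ⟨a, hac, hafix, haval⟩ := exists_adder vs ys c hvlen hndv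
  have hcT : Cost (toggle c fun x => !xs.all x) (4 * xs.length + 2) := by
    have h := (cost_toggle_all_of_dirty xs ys c h2 hnd).comp (cost_not c)
    convert h.mono (show _ ≤ 4 * xs.length + 2 by omega) using 1
    funext x
    have : xs.all (Function.update x c (xor (x c) true)) = xs.all x :=
      all_congr fun r hr => Function.update_of_ne (ne_of_mem_of_not_mem hr hcx) _ _
    simp only [toggle, Function.comp_apply, Function.update_self, Function.update_idem]
    rw [this]
    congr 1
    cases x c <;> cases xs.all x <;> rfl
  set T : Bits n → Bits n := toggle c fun x => !xs.all x with hT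
  set F : Bits n → Bits n := flipOn vs.toFinset with hF
  have hcF : Cost F ys.length :=
    (cost_flipOn _).mono ((List.toFinset_card_le _).trans hvlen.le)
  set W : Bits n → Bits n := fun x q => if q ∈ ys then xor (x q) (!x c) else x q with hW
  have hcW : Cost W (ys.length + 2) := cost_flip_unless ys c hcy
  have haZ : ∀ x, ((val ys (a x) : ℕ) : ZMod (2 ^ ys.length)) =
      val ys x + val vs x + (x c).toNat := by
    intro x
    rw [haval, ZMod.natCast_mod]
    push_cast
    ring
  have hvF : ∀ x, ((val vs (F x) : ℕ) : ZMod (2 ^ ys.length)) = -1 - val vs x := by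
    intro x
    have h := val_flip (qs := vs) (x := x) (y := F x) fun q hq => by simp [hF, flipOn, hq]
    have h' := congrArg (Nat.cast : ℕ → ZMod (2 ^ ys.length)) h
    rw [hvlen, ZMod.natCast_self] at h'
    push_cast at h'
    linear_combination h'
  -- Adding `vs` and then its complement `-1 - vs` cancels the unknown value, leaving `-1` plus the
  -- two values of `c`, which differ exactly when `xs.all x` fails. So `ys` changes by `0` if it
  -- fails and by `2 c - 1` otherwise. Conjugation by `W`, which complements `ys` when `c = 0`,
  -- turns the `-1` into `+1`.
  refine ⟨W ∘ T ∘ F ∘ a ∘ F ∘ T ∘ a ∘ W, ?_, ?_, ?_⟩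
  · exact (hcW.comp (hcT.comp (hcF.comp (hac.comp (hcF.comp (hcT.comp
      (hac.comp hcW))))))).mono (by omega)
  all_goals
    intro x
    set x0 := W x with hx0
    set x1 := a x0 with hx1
    set x2 := T x1 with hx2
    set x3 := F x2 with hx3
    set x4 := a x3 with hx4
    set x5 := F x4 with hx5
    set x6 := T x5 with hx6
    have e0 : ∀ q, q ∉ ys → x0 q = x q := fun q hq => by simp [hx0, hW, hq]
    have e1 : ∀ q, q ∉ ys → x1 q = x q := fun q hq => (hafix _ _ hq).trans (e0 q hq)
    have hA1 : xs.all x1 = xs.all x := all_congr fun q hq => e1 q (hdisj q hq)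
    have e2c : x2 c = xor (x c) (!xs.all x) := by
      rw [hx2, hT, toggle_same, hA1, e1 c hcy]
    have e2 : ∀ q, q ∉ ys → q ≠ c → x2 q = x q := fun q hq hqc => by
      rw [hx2, hT, toggle_ne hqc, e1 q hq]
    have e3 : ∀ q, q ∉ vs → x3 q = x2 q := fun q hq => by simp [hx3, hF, flipOn, hq]
    have e4 : ∀ q, q ∉ ys → x4 q = x3 q := fun q hq => hafix _ _ hq
    have e5 : ∀ q, q ∉ ys → x5 q = x2 q := fun q hq => by
      by_cases hqv : q ∈ vs
      · simp [hx5, hx3, hF, flipOn, hqv, e4 q hq]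
      · simp [hx5, hF, flipOn, hqv, e4 q hq, e3 q hqv]
    have hA5 : xs.all x5 = xs.all x := all_congr fun q hq => by
      rw [e5 q (hdisj q hq), e2 q (hdisj q hq) (ne_of_mem_of_not_mem hq hcx)]
    have e6 : ∀ q, q ∉ ys → x6 q = x q := fun q hq => by
      by_cases hqc : q = c
      · subst hqc
        rw [hx6, hT, toggle_same, hA5, e5 q hq, e2c]
        cases x q <;> cases xs.all x <;> rfl
      · rw [hx6, hT, toggle_ne hqc, e5 q hq, e2 q hq hqc]
  · intro q hq
    change W x6 q = x q
    simp [hW, hq, e6 q hq]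
  · simp only [Function.comp_apply, ← hx0, ← hx1, ← hx2, ← hx3, ← hx4, ← hx5, ← hx6]
    have hvy : ∀ q ∈ vs, q ∉ ys := fun q hq => hdisj q (hvx q hq)
    have hvc : ∀ q ∈ vs, q ≠ c := fun q hq h => hcx (h ▸ hvx q hq)
    have hcv : c ∉ vs := fun h => hcx (hvx c h)
    have f6 : val ys x6 = val ys x4 := val_congr fun q hq => by
      rw [hx6, hT, toggle_ne (ne_of_mem_of_not_mem hq hcy), hx5, hF, flipOn,
        if_neg (fun h => hvy q (by simpa using h) hq)]
    have f3 : val ys x3 = val ys x1 := val_congr fun q hq => by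
      rw [hx3, hF, flipOn, if_neg (fun h => hvy q (by simpa using h) hq), hx2, hT,
        toggle_ne (ne_of_mem_of_not_mem hq hcy)]
    have g2 : val vs x2 = val vs x := val_congr fun q hq => e2 q (hvy q hq) (hvc q hq)
    have g0 : val vs x0 = val vs x := val_congr fun q hq => e0 q (hvy q hq)
    have key : ((val ys x6 : ℕ) : ZMod (2 ^ ys.length)) =
        val ys x0 - 1 + (x c).toNat + (xor (x c) (!xs.all x)).toNat := by
      rw [f6, hx4, haZ, f3, hx1, haZ, hx3, hvF, g2, g0, e0 c hcy, ← hx3, e3 c hcv, e2c]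
      ring
    have hW' : ∀ z, ((val ys (W z) : ℕ) : ZMod (2 ^ ys.length)) =
        if z c then (val ys z : ZMod (2 ^ ys.length)) else -1 - val ys z := by
      intro z
      cases hz : z c
      · have h := val_flip (qs := ys) (x := z) (y := W z) fun q hq => by simp [hW, hq, hz]
        have h' := congrArg (Nat.cast : ℕ → ZMod (2 ^ ys.length)) h
        rw [ZMod.natCast_self] at h'
        push_cast at h'
        simp only [Bool.false_eq_true, if_false]
        linear_combination h'
      · rw [if_pos rfl]
        congr 1
        exact val_congr fun q hq => by simp [hW, hz]
    have hfin : ((val ys (W x6) : ℕ) : ZMod (2 ^ ys.length)) =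
        ((val ys x + (xs.all x).toNat : ℕ) : ZMod (2 ^ ys.length)) := by
      rw [hW', key, e6 c hcy, hx0, hW']
      push_cast
      cases x c <;> cases xs.all x <;> simp <;> ring
    rw [ZMod.natCast_eq_natCast_iff', Nat.mod_eq_of_lt (val_lt _ _)] at hfin
    exact hfin

/-! ### Phases and flips with many controls -/

theorem PhaseCost.congr {φ ψ : Bits n → ℝ} {k : ℕ} (h : PhaseCost φ k) (e : ∀ x, φ x = ψ x) :
    PhaseCost ψ k := (funext e : φ = ψ) ▸ h

/-- This is the identity `2 a b = a + b - (a ⊕ b)` for bits, applied to phases. -/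
theorem phaseCost_and {a b : Fin n} (hab : a ≠ b) (θ : ℝ) :
    PhaseCost (fun x => if x a && x b then θ else 0) 5 := by
  have h := ((phaseCost_bit a (θ / 2)).add (phaseCost_bit b (θ / 2))).add
    ((phaseCost_bit b (-(θ / 2))).comp (cost_cnot hab))
  refine (h.mono (by norm_num)).congr fun x => ?_
  rw [toggle_same]
  cases x a <;> cases x b <;> simp

/-- `val` is linear in the bits, so the phase splits into two-qubit phases with weights `θ * 2 ^ i`.
-/
theorem phaseCost_and_val (c : Fin n) (ys : List (Fin n)) (hc : c ∉ ys) (θ : ℝ) :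
    PhaseCost (fun x => if x c then θ * val ys x else 0) (5 * ys.length) := by
  induction ys generalizing θ with
  | nil =>
    refine (phaseCost_zero _).congr fun x => ?_
    simp [val]
  | cons y ys ih =>
    have hcy : c ≠ y := fun h => hc (by simp [h])
    have h := (phaseCost_and hcy θ).add (ih (fun h => hc (by simp [h])) (2 * θ))
    refine (h.mono (by simp only [List.length_cons]; omega)).congr fun x => ?_
    cases hxc : x c <;> cases hxy : x y <;> simp [val, hxy] <;> ring

/-- A phase shift controlled by `k` qubits needs only `O(k)` gates, and no further qubits. -/
theorem phaseCost_all (qs : List (Fin n)) (hqs : qs ≠ []) (hnd : qs.Nodup) (θ : ℝ) :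
    PhaseCost (fun x => if qs.all x then θ else 0) (90 * qs.length) := by
  induction hk : qs.length using Nat.strong_induction_on generalizing qs θ with
  | _ k ih =>
    match qs, hqs with
    | [a], _ =>
      refine ((phaseCost_bit a θ).mono (by simp at hk; omega)).congr fun x => by simp
    | [a, b], _ =>
      have hab : a ≠ b := by simpa using hnd
      refine ((phaseCost_and hab θ).mono (by simp at hk; omega)).congr fun x => by simp
    | c :: a :: b :: rs, _ =>
      set qs := a :: b :: rs with hqs
      have hql : qs.length = rs.length + 2 := rfl
      set m := qs.length / 2 with hm
      set ys := qs.take m with hys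
      set xs := qs.drop m with hxs
      have hyl : ys.length = m := by simp only [hys, List.length_take]; omega
      have hxl : xs.length = qs.length - m := by simp [hxs]
      have hap : ys ++ xs = qs := List.take_append_drop m qs
      have hnd' : (c :: (xs ++ ys)).Nodup :=
        ((List.perm_append_comm.cons c).nodup_iff).2 (by rw [hap]; exact hnd)
      have hcx : c ∉ xs := by
        simp only [List.nodup_cons, List.mem_append] at hnd'
        grind
      have hcy : c ∉ ys := by
        simp only [List.nodup_cons, List.mem_append] at hnd'
        grind
      have hxy : ∀ q ∈ xs, q ∉ ys := by
        simp only [List.nodup_cons, List.nodup_append] at hnd'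
        grind
      have hkl : k = qs.length + 1 := by rw [← hk]; rfl
      obtain ⟨E, hE, hEfix, hEval⟩ := exists_increment xs ys c (by omega) (by omega) hnd'
      have hrec := ih (c :: xs).length (by simp only [List.length_cons]; omega) (c :: xs)
        (by simp) (hnd'.sublist ((List.sublist_append_left xs ys).cons_cons c)) (θ / 2 ^ m) rfl
      -- With `X = xs.all x` and `v = val ys x`, the quantity `X + v - ((v + X) mod 2 ^ m)` is `2 ^
      -- m` when all bits of `xs` and `ys` are set, and `0` otherwise: only then does the increment
      -- wrap around.
      have h := (hrec.add (phaseCost_and_val c ys hcy (θ / 2 ^ m))).add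
        ((phaseCost_and_val c ys hcy (-(θ / 2 ^ m))).comp hE)
      -- Beyond the recursive call the cost is `5 m + 5 m + 2 (24 m + 16) = 58 m + 32`, which is at
      -- most `90 m` because `m ≥ 1`.
      refine (h.mono (by simp only [List.length_cons]; omega)).congr fun x => ?_
      have hB := all_iff_val ys x
      have hlt := val_lt ys x
      have hall : (c :: qs).all x = (x c && xs.all x && ys.all x) := by
        rw [List.all_cons, ← hap, List.all_append]
        cases x c <;> cases xs.all x <;> cases ys.all x <;> rfl
      rw [hall, List.all_cons, hEval, hEfix x c hcy]
      rw [hyl] at *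
      have hpow : (2 : ℝ) ^ m ≠ 0 := by positivity
      cases hxc : x c
      · simp
      · cases hA : xs.all x
        · simp [Nat.mod_eq_of_lt hlt]
        · cases hBx : ys.all x
          · have hne : val ys x + 1 ≠ 2 ^ m := fun h => by
              rw [hB.2 h] at hBx; cases hBx
            simp only [Bool.toNat_true, Bool.and_true, Bool.and_false, if_true,
              Bool.false_eq_true, if_false]
            rw [Nat.mod_eq_of_lt (by omega)]
            push_cast
            ring
          · have he := hB.1 hBx
            have he' : (val ys x : ℝ) = 2 ^ m - 1 := by
              rw [eq_sub_iff_add_eq]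
              exact_mod_cast he
            simp only [Bool.toNat_true, Bool.and_true, if_true]
            rw [he, Nat.mod_self, he']
            field_simp
            simp

/-- A bit flip controlled by `k` qubits needs only `O(k)` gates, and no further qubits. -/
theorem cost_toggle_all (qs : List (Fin n)) (t : Fin n) (hnd : (t :: qs).Nodup) :
    Cost (toggle t qs.all) (90 * qs.length + 92) := by
  have ht : t ∉ qs := (List.nodup_cons.1 hnd).1
  refine (cost_toggle_of_phaseCost (fun x b => ?_)
    ((phaseCost_all (t :: qs) (by simp) hnd Real.pi).congr fun x => ?_)).mono ?_
  · exact all_congr fun q hq => Function.update_of_ne (ne_of_mem_of_not_mem hq ht) _ _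
  · rw [List.all_cons]
  · simp only [List.length_cons]
    omega

theorem cost_toggle_forall (D : Finset (Fin n)) (t : Fin n) (ht : t ∉ D) :
    Cost (toggle t fun x => decide (∀ q ∈ D, x q = true)) (90 * D.card + 92) := by
  have h := cost_toggle_all D.toList t (List.nodup_cons.2 ⟨by simpa using ht, D.nodup_toList⟩)
  rw [Finset.length_toList] at h
  convert h using 2
  funext x
  rw [Bool.eq_iff_iff]
  simp

/-! ### Transpositions and placement on few qubits -/

/-- All bits outside `R` vanish. -/
def ZeroOff (R : Finset (Fin n)) (x : Bits n) : Prop := ∀ q, q ∉ R → x q = false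

theorem ZeroOff.mono {R S : Finset (Fin n)} {x : Bits n} (h : ZeroOff R x) (hRS : R ⊆ S) :
    ZeroOff S x := fun q hq => h q fun hR => hq (hRS hR)

/-- CNOT gates from a bit `t` where `a` and `b` differ, followed by flips, bring both to all ones on
the rest of `R`; a controlled flip of `t` then swaps them. Controls outside `R` are unnecessary on
states vanishing there, so the cost depends on `R.card` and not on `n`. -/
theorem exists_cost_swap (R : Finset (Fin n)) {a b : Bits n} (ha : ZeroOff R a)
    (hb : ZeroOff R b) :
    ∃ f : Bits n → Bits n, Cost f (94 * R.card + 92) ∧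
      ∀ x, ZeroOff R x → f x = Equiv.swap a b x := by
  by_cases hab : a = b
  · refine ⟨id, cost_id _, fun x _ => ?_⟩
    subst hab
    simp
  obtain ⟨t, ht⟩ : ∃ t, a t ≠ b t := Function.ne_iff.1 hab
  have htR : t ∈ R := by
    by_contra h
    exact ht ((ha t h).trans (hb t h).symm)
  set D : Finset (Fin n) := (R.erase t).filter fun q => a q ≠ b q with hD
  set a' : Bits n := fanout D (fun _ => t) a with ha'
  set M : Finset (Fin n) := (R.erase t).filter fun q => a' q = false with hM
  have hDR : D ⊆ R.erase t := Finset.filter_subset _ _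
  have hMR : M ⊆ R.erase t := Finset.filter_subset _ _
  have hcard : (R.erase t).card + 1 = R.card := Finset.card_erase_add_one htR
  have htD : t ∉ D := fun h => by simpa using hDR h
  have htM : t ∉ M := fun h => by simpa using hMR h
  have hA0 : Cost (flipOn M ∘ fanout D fun _ => t) (2 * R.card) := by
    refine ((cost_flipOn M).comp (cost_fanout D (fun _ => t) fun _ _ => htD)).mono ?_
    have := Finset.card_le_card hDR
    have := Finset.card_le_card hMR
    omega
  obtain ⟨A, hA⟩ := hA0.exists_perm
  have hF := cost_toggle_forall (R.erase t) t (Finset.notMem_erase t R)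
  set F : Bits n → Bits n := toggle t fun x => decide (∀ q ∈ R.erase t, x q = true) with hFdef
  rw [← hA] at hA0
  refine ⟨(A⁻¹ : Equiv.Perm _) ∘ F ∘ A, (hA0.inv.comp (hF.comp hA0)).mono (by omega), ?_⟩
  have hAz : ∀ x, ZeroOff R x → ZeroOff R (A x) := by
    intro x hx q hq
    have h1 : q ∉ D := fun h => hq (Finset.mem_of_mem_erase (hDR h))
    have h2 : q ∉ M := fun h => hq (Finset.mem_of_mem_erase (hMR h))
    simp [hA, flipOn, fanout, h1, h2, hx q hq]
  have hAt : ∀ x, A x t = x t := by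
    intro x
    simp [hA, flipOn, fanout, htD, htM]
  have hAa : ∀ q ∈ R.erase t, A a q = true := by
    intro q hq
    simp only [hA, Function.comp_apply, ← ha', flipOn, hM, Finset.mem_filter, hq, true_and]
    cases h : a' q <;> simp
  have hAb : ∀ q ∈ R.erase t, A b q = true := by
    intro q hq
    rw [← hAa q hq, hA]
    simp only [Function.comp_apply, flipOn]
    have : fanout D (fun _ => t) b q = fanout D (fun _ => t) a q := by
      simp only [fanout, hD, Finset.mem_filter, hq, true_and]
      revert ht
      cases a t <;> cases b t <;> cases a q <;> cases b q <;> simp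
    rw [this]
  have huniq : ∀ y z : Bits n, ZeroOff R y → ZeroOff R z → (∀ q ∈ R.erase t, y q = true) →
      (∀ q ∈ R.erase t, z q = true) → y t = z t → y = z := by
    intro y z hy hz hy1 hz1 hyz
    funext q
    by_cases hqt : q = t
    · rw [hqt, hyz]
    · by_cases hqR : q ∈ R
      · have := Finset.mem_erase.2 ⟨hqt, hqR⟩
        rw [hy1 q this, hz1 q this]
      · rw [hy q hqR, hz q hqR]
  have hFz : ∀ y, ZeroOff R y → ZeroOff R (F y) := by
    intro y hy q hq
    rw [hFdef, toggle_ne (fun h : q = t => hq (h ▸ htR)), hy q hq]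
  have hFe : ∀ y, ∀ q ∈ R.erase t, F y q = y q := fun y q hq =>
    toggle_ne (Finset.ne_of_mem_erase hq) _ _
  have hFt : ∀ y : Bits n, (∀ q ∈ R.erase t, y q = true) → F y t = !y t := by
    intro y hy
    rw [hFdef, toggle_same, decide_eq_true hy]
    simp
  have key : ∀ y, ZeroOff R y → F y = Equiv.swap (A a) (A b) y := by
    intro y hy
    by_cases hall : ∀ q ∈ R.erase t, y q = true
    · by_cases h1 : y t = a t
      · have : y = A a := huniq _ _ hy (hAz a ha) hall hAa (h1.trans (hAt a).symm)
        subst this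
        rw [Equiv.swap_apply_left]
        refine huniq _ _ (hFz _ hy) (hAz b hb) (fun q hq => (hFe _ q hq).trans (hall q hq)) hAb ?_
        rw [hFt _ hall, hAt, hAt]
        revert ht
        cases a t <;> cases b t <;> simp
      · have h2 : y t = b t := by
          revert h1 ht
          cases a t <;> cases b t <;> cases y t <;> simp
        have : y = A b := huniq _ _ hy (hAz b hb) hall hAb (h2.trans (hAt b).symm)
        subst this
        rw [Equiv.swap_apply_right]
        refine huniq _ _ (hFz _ hy) (hAz a ha) (fun q hq => (hFe _ q hq).trans (hall q hq)) hAa ?_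
        rw [hFt _ hall, hAt, hAt]
        revert ht
        cases a t <;> cases b t <;> simp
    · rw [Equiv.swap_apply_of_ne_of_ne (by rintro rfl; exact hall hAa)
        (by rintro rfl; exact hall hAb)]
      rw [hFdef, toggle, decide_eq_false hall]
      simp
  intro x hx
  simp only [Function.comp_apply]
  rw [key _ (hAz x hx), Equiv.swap_apply_apply]
  simp

/-- One transposition per point suffices: swapping the current position of `p i` with `e i` leaves
points already placed alone, by injectivity. -/
theorem exists_placement {ι : Type*} [Fintype ι] (R : Finset (Fin n)) {p e : ι → Bits n}
    (hp : Function.Injective p) (he : Function.Injective e) (hpz : ∀ i, ZeroOff R (p i))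
    (hez : ∀ i, ZeroOff R (e i)) :
    ∃ f : Bits n → Bits n, Cost f (Fintype.card ι * (94 * R.card + 92)) ∧
      ∀ i, f (p i) = e i := by
  classical
  suffices H : ∀ S : Finset ι, ∃ f : Bits n → Bits n, Cost f (S.card * (94 * R.card + 92)) ∧
      (∀ x, ZeroOff R x → ZeroOff R (f x)) ∧ ∀ i ∈ S, f (p i) = e i by
    obtain ⟨f, hf, -, h⟩ := H Finset.univ
    exact ⟨f, hf, fun i => h i (Finset.mem_univ i)⟩
  intro S
  induction S using Finset.induction_on with
  | empty => exact ⟨id, cost_id _, fun _ h => h, by simp⟩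
  | insert i S hi ih =>
    obtain ⟨f, hf, hz, hfS⟩ := ih
    obtain ⟨g, hg, hgs⟩ := exists_cost_swap R (hz _ (hpz i)) (hez i)
    refine ⟨g ∘ f, ?_, ?_, ?_⟩
    · rw [Finset.card_insert_of_notMem hi]
      exact (hg.comp hf).mono (by rw [add_mul, one_mul, add_comm])
    · intro x hx
      rw [Function.comp_apply, hgs _ (hz x hx)]
      by_cases h1 : f x = f (p i)
      · rw [h1, Equiv.swap_apply_left]
        exact hez i
      · by_cases h2 : f x = e i
        · rw [h2, Equiv.swap_apply_right]
          exact hz _ (hpz i)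
        · rw [Equiv.swap_apply_of_ne_of_ne h1 h2]
          exact hz x hx
    · intro l hl
      rw [Function.comp_apply, hgs _ (hz _ (hpz l))]
      rcases Finset.mem_insert.1 hl with rfl | hl
      · rw [Equiv.swap_apply_left]
      · have hli : l ≠ i := fun h => hi (h ▸ hl)
        rw [Equiv.swap_apply_of_ne_of_ne, hfS l hl]
        · exact fun h => hli (hp (hf.bijective.1 h))
        · rw [hfS l hl]
          exact fun h => hli (he h)

/-- If two columns of the table of the points `p i` agree, then one of them can be cleared with a
single CNOT gate. -/
theorem exists_clear_columns {ι : Type*} [Fintype ι] (hn : 0 < n) (p : ι → Bits n) :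
    ∃ (f : Bits n → Bits n) (R : Finset (Fin n)), Cost f n ∧ R.card ≤ 2 ^ Fintype.card ι ∧
      ∀ i, ZeroOff R (f (p i)) := by
  classical
  have : Nonempty (Fin n) := ⟨⟨0, hn⟩⟩
  set col : Fin n → ι → Bool := fun q i => p i q with hcol
  -- One representative qubit per column pattern. The image runs over all `2 ^ Fintype.card ι`
  -- patterns; one that does not occur contributes an arbitrary qubit, which is harmless.
  set R : Finset (Fin n) := Finset.univ.image (Function.invFun col) with hR
  have hrR : ∀ q, Function.invFun col (col q) ∈ R := fun q =>
    Finset.mem_image_of_mem _ (Finset.mem_univ _)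
  refine ⟨fanout Rᶜ fun q => Function.invFun col (col q), R, ?_, ?_, ?_⟩
  · exact (cost_fanout _ _ fun q _ => by simp [hrR q]).mono
      ((Finset.card_le_univ _).trans (by simp))
  · exact Finset.card_image_le.trans (by simp)
  · intro i q hq
    have h : col (Function.invFun col (col q)) = col q := Function.invFun_eq ⟨q, rfl⟩
    have h' : p i (Function.invFun col (col q)) = p i q := congrFun h i
    simp [fanout, hq, h']

/-! ### Exchanging many pairs at once -/

open Classical in
/-- Exchanging `2 ^ j` disjoint pairs of basis states takes only `O(n)` gates if `j` is small. -/
theorem exists_pair_exchange {j : ℕ} (hn : 0 < n) (hj : j = 0 ∨ 4 ^ 2 ^ (j + 1) ≤ n)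
    {p : Bool × Bits j → Bits n} (hp : Function.Injective p) :
    ∃ f : Bits n → Bits n, Cost f (562 * n) ∧ (∀ b z, f (p (b, z)) = p (!b, z)) ∧
      ∀ x, x ∉ Set.range p → f x = x := by
  rcases hj with rfl | hj
  · have hz : ∀ x : Bits n, ZeroOff Finset.univ x := fun x q hq => absurd (Finset.mem_univ q) hq
    obtain ⟨f, hf, hfs⟩ := exists_cost_swap Finset.univ (hz (p (true, default)))
      (hz (p (false, default)))
    refine ⟨f, hf.mono (by simp; omega), ?_, ?_⟩
    · intro b z
      rw [hfs _ (hz _), Subsingleton.elim z default]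
      cases b
      · exact Equiv.swap_apply_right _ _
      · exact Equiv.swap_apply_left _ _
    · intro x hx
      rw [hfs _ (hz _)]
      exact Equiv.swap_apply_of_ne_of_ne (fun h => hx ⟨_, h.symm⟩) (fun h => hx ⟨_, h.symm⟩)
  have hk : j + 1 < 2 ^ (j + 1) := Nat.lt_two_pow_self
  have hkk : 2 ^ (j + 1) < 2 ^ 2 ^ (j + 1) := Nat.lt_two_pow_self
  have hsq : 2 ^ 2 ^ (j + 1) * 2 ^ 2 ^ (j + 1) = 4 ^ 2 ^ (j + 1) := by
    rw [← mul_pow]; rfl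
  have hjn : j + 1 ≤ n := by nlinarith
  set T : Finset (Fin n) := Finset.univ.image (Fin.castLE hjn) with hT
  have hTcard : T.card ≤ j + 1 := Finset.card_image_le.trans (by simp)
  have hmT : ∀ q : Fin n, q ∈ T ↔ q.val < j + 1 := by
    intro q
    simp only [hT, Finset.mem_image, Finset.mem_univ, true_and]
    constructor
    · rintro ⟨i, rfl⟩
      exact i.isLt
    · intro h
      exact ⟨⟨q, h⟩, rfl⟩
  -- The target positions fill the subcube spanned by the first `j + 1` qubits, with `b` in the
  -- first one, so that exchanging `(b, z)` with `(!b, z)` is a flip of a single qubit.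
  set e : Bool × Bits j → Bits n := fun w q =>
    if h : q.val < j + 1 then (Fin.cons w.1 w.2 : Fin (j + 1) → Bool) ⟨q, h⟩ else false with he
  have hecast : ∀ w i, e w (Fin.castLE hjn i) = (Fin.cons w.1 w.2 : Fin (j + 1) → Bool) i := by
    intro w i
    exact dif_pos i.isLt
  have hez : ∀ w, ZeroOff T (e w) := by
    intro w q hq
    rw [hmT] at hq
    exact dif_neg hq
  have heinj : Function.Injective e := by
    intro w w' h
    have h1 : (Fin.cons w.1 w.2 : Fin (j + 1) → Bool) = Fin.cons w'.1 w'.2 := by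
      funext i
      rw [← hecast, ← hecast, h]
    exact Prod.ext (Fin.cons_inj.1 h1).1 (Fin.cons_inj.1 h1).2
  obtain ⟨f₁, R, hf₁, hR, hz⟩ := exists_clear_columns hn p
  obtain ⟨f₂, hf₂, hpe⟩ := exists_placement (R ∪ T) (hf₁.bijective.1.comp hp) heinj
    (fun i => (hz i).mono Finset.subset_union_left) (fun i => (hez i).mono Finset.subset_union_right)
  have hcard : Fintype.card (Bool × Bits j) = 2 ^ (j + 1) := by
    simp [pow_succ, mul_comm]
  have hA : Cost (f₂ ∘ f₁) (189 * n) := by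
    refine (hf₂.comp hf₁).mono ?_
    have h1 : (R ∪ T).card ≤ 2 ^ 2 ^ (j + 1) + (j + 1) :=
      (Finset.card_union_le R T).trans (by rw [hcard] at hR; omega)
    rw [hcard]
    have h2 : 94 * (R ∪ T).card + 92 ≤ 188 * 2 ^ 2 ^ (j + 1) := by omega
    calc 2 ^ (j + 1) * (94 * (R ∪ T).card + 92) + n
        ≤ 2 ^ 2 ^ (j + 1) * (188 * 2 ^ 2 ^ (j + 1)) + n := by gcongr
      _ = 188 * 4 ^ 2 ^ (j + 1) + n := by rw [← hsq]; ring
      _ ≤ 189 * n := by omega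
  obtain ⟨A, hAf⟩ := hA.exists_perm
  rw [← hAf] at hA
  have hAp : ∀ w, A (p w) = e w := by
    intro w
    rw [hAf]
    exact hpe w
  set o : Fin n := Fin.castLE hjn 0 with ho
  have hoT : o ∈ T := Finset.mem_image_of_mem _ (Finset.mem_univ _)
  have hG := (cost_flipOn Tᶜ).comp ((cost_toggle_forall Tᶜ o (by simp [hoT])).comp (cost_flipOn Tᶜ))
  have hTn : (Tᶜ : Finset (Fin n)).card ≤ n := (Finset.card_le_univ _).trans (by simp)
  have hGeq : flipOn Tᶜ ∘ (toggle o fun x => decide (∀ q ∈ Tᶜ, x q = true)) ∘ flipOn Tᶜ =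
      toggle o fun x => decide (ZeroOff T x) := by
    funext x q
    have hdec : (∀ q ∈ Tᶜ, flipOn Tᶜ x q = true) ↔ ZeroOff T x := by
      refine forall_congr' fun q => ?_
      rw [Finset.mem_compl]
      refine imp_congr_right fun hq => ?_
      simp [flipOn, hq]
    have hflip : ∀ (y : Bits n) (q : Fin n), q ∈ T → flipOn Tᶜ y q = y q := fun y q hq => by
      simp [flipOn, hq]
    simp only [Function.comp_apply]
    by_cases hqo : q = o
    · rw [hqo, hflip _ o hoT, toggle_same, toggle_same, hflip _ o hoT, decide_eq_decide.2 hdec]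
    · rw [toggle_ne hqo]
      by_cases hqT : q ∈ T
      · rw [hflip _ q hqT, toggle_ne hqo, hflip _ q hqT]
      · simp [flipOn, hqT, toggle_ne hqo]
  rw [hGeq] at hG
  -- The gates number at most `2 * 189 n` for `A` and its inverse, `2 n` for the flips and `90 n +
  -- 92` for the controlled flip, hence `562 n` in all.
  refine ⟨(A⁻¹ : Equiv.Perm _) ∘ (toggle o fun x => decide (ZeroOff T x)) ∘ A,
    (hA.inv.comp (hG.comp hA)).mono (by omega), ?_, ?_⟩
  · intro b z
    simp only [Function.comp_apply]
    rw [Equiv.Perm.inv_eq_iff_eq, hAp, hAp]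
    funext q
    rw [toggle_apply, decide_eq_true (hez _)]
    by_cases hqo : q = o
    · rw [if_pos hqo, hqo, ho, hecast, hecast]
      simp
    · rw [if_neg hqo]
      by_cases hqT : q ∈ T
      · obtain ⟨i, -, rfl⟩ := Finset.mem_image.1 hqT
        rw [hecast, hecast]
        cases i using Fin.cases with
        | zero => exact absurd rfl hqo
        | succ i => simp
      · rw [hez _ q hqT, hez _ q hqT]
  · intro x hx
    simp only [Function.comp_apply]
    rw [Equiv.Perm.inv_eq_iff_eq, toggle, decide_eq_false, Bool.xor_false,
      Function.update_eq_self]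
    -- The subcube consists exactly of the images `A (p w)`, so a point outside the range of `p`
    -- misses it, wherever else `A` sends that point.
    intro h
    apply hx
    refine ⟨(A x o, fun i => A x (Fin.castLE hjn i.succ)), A.injective ?_⟩
    rw [hAp]
    funext q
    by_cases hqT : q ∈ T
    · obtain ⟨i, -, rfl⟩ := Finset.mem_image.1 hqT
      rw [hecast]
      cases i using Fin.cases with
      | zero => simp [ho]
      | succ i => simp
    · rw [hez _ q hqT, h q hqT]

/-! ### Peeling blocks off a permutation -/

/-- Greedy choice: each chosen `x` excludes only `x`, `σ x` and `σ⁻¹ x`, so a further point exists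
while `3 * S.card < permSize σ`. The slack `+ 2` lets single transpositions be peeled off down to
the identity. -/
theorem exists_disjoint_image (σ : Equiv.Perm (Bits n)) (N : ℕ) (hN : 3 * N ≤ permSize σ + 2) :
    ∃ S : Finset (Bits n), S.card = N ∧ ∀ x ∈ S, σ x ∉ S := by
  induction N with
  | zero => exact ⟨∅, rfl, by simp⟩
  | succ N ih =>
    obtain ⟨S, hS, h⟩ := ih (by omega)
    set B : Finset (Bits n) := S ∪ S.image σ ∪ S.image σ.symm with hB
    have hcard : B.card < permSize σ := by
      rw [hB]
      have h1 : (S.image σ).card ≤ S.card := Finset.card_image_le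
      have h2 : (S.image σ.symm).card ≤ S.card := Finset.card_image_le
      have h3 := Finset.card_union_le (S ∪ S.image σ) (S.image σ.symm)
      have h4 := Finset.card_union_le S (S.image σ)
      omega
    obtain ⟨x, hx, hxB⟩ := Finset.exists_mem_notMem_of_card_lt_card hcard
    simp only [hB, Finset.mem_union, Finset.mem_image, not_or, not_exists, not_and] at hxB
    obtain ⟨⟨hxS, hx1⟩, hx2⟩ := hxB
    refine ⟨insert x S, by rw [Finset.card_insert_of_notMem hxS, hS], ?_⟩
    intro y hy hy'
    rcases Finset.mem_insert.1 hy with rfl | hyS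
    · rcases Finset.mem_insert.1 hy' with h1 | h1
      · simp [h1] at hx
      · exact hx2 _ h1 (by simp)
    · rcases Finset.mem_insert.1 hy' with h1 | h1
      · exact hx1 _ hyS h1
      · exact h _ hyS h1

theorem exists_reduce (hn : 0 < n) {j : ℕ} (hj : j = 0 ∨ 4 ^ 2 ^ (j + 1) ≤ n)
    (σ : Equiv.Perm (Bits n)) (hs : 3 * 2 ^ j ≤ permSize σ + 2) :
    ∃ τ σ' : Equiv.Perm (Bits n), Cost τ (562 * n) ∧ σ = τ * σ' ∧
      permSize σ' + 2 ^ j ≤ permSize σ := by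
  obtain ⟨S, hS, hdisj⟩ := exists_disjoint_image σ _ hs
  have hc : Fintype.card (Bits j) = Fintype.card S := by simp [hS]
  let s : Bits j ≃ S := Fintype.equivOfCardEq hc
  let p : Bool × Bits j → Bits n := fun w => if w.1 then σ (s w.2) else s w.2
  have hp : Function.Injective p := by
    rintro ⟨b, z⟩ ⟨b', z'⟩ h
    cases b <;> cases b' <;> simp only [p, if_true, Bool.false_eq_true, if_false] at h
    · rw [s.injective (Subtype.ext h)]
    · exact absurd (h ▸ (s z).2) (hdisj _ (s z').2)
    · exact absurd (h ▸ (s z').2) (hdisj _ (s z).2)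
    · rw [s.injective (Subtype.ext (σ.injective h))]
  obtain ⟨f, hf, hfp, hfix⟩ := exists_pair_exchange hn hj hp
  obtain ⟨τ, rfl⟩ := hf.exists_perm
  refine ⟨τ⁻¹, τ * σ, hf.inv, by simp, ?_⟩
  have hSσ : ∀ x ∈ S, τ (σ x) = x := by
    intro x hx
    have h := hfp true (s.symm ⟨x, hx⟩)
    simpa [p] using h
  have hsub : (Finset.univ.filter fun x => (τ * σ) x ≠ x) ⊆
      (Finset.univ.filter fun x => σ x ≠ x) \ S := by
    intro x hx
    replace hx : τ (σ x) ≠ x := (Finset.mem_filter.1 hx).2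
    simp only [Finset.mem_filter, Finset.mem_univ, true_and, Finset.mem_sdiff]
    refine ⟨fun h => hx ?_, fun h => hx (hSσ x h)⟩
    -- A fixed point of `σ` lies neither in `S` nor in `σ S`, so the exchange does not touch it.
    have hxS : x ∉ S := fun hxS => hdisj x hxS (h.symm ▸ hxS)
    rw [h]
    refine hfix x ?_
    rintro ⟨⟨b, z⟩, hz⟩
    cases b <;> simp only [p, if_true, Bool.false_eq_true, if_false] at hz
    · exact hxS (hz ▸ (s z).2)
    · have : (s z : Bits n) = x := σ.injective (hz.trans h.symm)
      exact hxS (this ▸ (s z).2)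
  have hSsub : S ⊆ Finset.univ.filter fun x => σ x ≠ x := by
    intro x hx
    simp only [Finset.mem_filter, Finset.mem_univ, true_and]
    exact fun h => hdisj x hx (h.symm ▸ hx)
  have h1 := Finset.card_le_card hsub
  rw [Finset.card_sdiff_of_subset hSsub, hS] at h1
  have h2 := Finset.card_le_card hSsub
  rw [hS] at h2
  simp only [permSize]
  omega

theorem eq_one_of_permSize_eq_zero {σ : Equiv.Perm (Bits n)} (h : permSize σ = 0) : σ = 1 := by
  ext1 x
  by_contra hx
  have : x ∈ (Finset.univ.filter fun x => σ x ≠ x) := by simpa using hx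
  rw [Finset.card_eq_zero.1 h] at this
  simp at this

theorem permSize_ne_one (σ : Equiv.Perm (Bits n)) : permSize σ ≠ 1 := by
  intro h
  obtain ⟨x, hx⟩ := Finset.card_eq_one.1 h
  have h1 : σ x ≠ x := by
    have : x ∈ (Finset.univ.filter fun x => σ x ≠ x) := by rw [hx]; simp
    simpa using this
  have h2 : σ x ∈ (Finset.univ.filter fun x => σ x ≠ x) := by
    simpa using h1
  rw [hx] at h2
  exact h1 (by simpa using h2)

/-- Blocks of size `2 ^ j` are peeled off while at least `3 * 2 ^ j` points move, then `j` is
lowered; `3 * j` pays for the leftovers of all levels. -/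
theorem cost_perm (hn : 0 < n) {j : ℕ} (hj : j = 0 ∨ 4 ^ 2 ^ (j + 1) ≤ n)
    (σ : Equiv.Perm (Bits n)) : Cost σ (562 * n * (permSize σ / 2 ^ j + 3 * j)) := by
  induction j generalizing σ with
  | zero =>
    induction hs : permSize σ using Nat.strong_induction_on generalizing σ with
    | _ s ih =>
      rcases Nat.eq_zero_or_pos s with rfl | hpos
      · rw [eq_one_of_permSize_eq_zero hs]
        exact cost_id _
      · obtain ⟨τ, σ', hτ, rfl, hσ'⟩ := exists_reduce hn hj σ (by omega)
        refine (hτ.comp (ih (permSize σ') (by omega) σ' rfl)).mono ?_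
        rw [add_comm, ← Nat.mul_succ]
        refine Nat.mul_le_mul_left _ ?_
        simp only [pow_zero, Nat.div_one] at *
        omega
  | succ j ihj =>
    have hj' : j = 0 ∨ 4 ^ 2 ^ (j + 1) ≤ n := Or.inr <| by
      rcases hj with h | h
      · omega
      · exact le_trans (Nat.pow_le_pow_right (by norm_num)
          (Nat.pow_le_pow_right (by norm_num) (by omega))) h
    induction hs : permSize σ using Nat.strong_induction_on generalizing σ with
    | _ s ih =>
      by_cases hlt : 3 * 2 ^ (j + 1) ≤ s
      · obtain ⟨τ, σ', hτ, rfl, hσ'⟩ := exists_reduce hn hj σ (by omega)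
        have hpos : 0 < 2 ^ (j + 1) := by positivity
        refine (hτ.comp (ih (permSize σ') (by omega) σ' rfl)).mono ?_
        rw [add_comm, ← Nat.mul_succ]
        refine Nat.mul_le_mul_left _ ?_
        have h1 : permSize σ' / 2 ^ (j + 1) + 1 ≤ s / 2 ^ (j + 1) := by
          rw [← Nat.add_div_right _ hpos]
          exact Nat.div_le_div_right (by omega)
        omega
      · refine (ihj hj' σ).mono (Nat.mul_le_mul_left _ ?_)
        rw [hs, pow_succ, ← Nat.div_div_eq_div_mul]
        -- A quotient `u ≤ 5` satisfies `u ≤ u / 2 + 3`, so passing to the next lower level costs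
        -- three blocks at most.
        have h1 : s / 2 ^ j < 6 := by
          rw [Nat.div_lt_iff_lt_mul (by positivity)]
          rw [pow_succ] at hlt
          omega
        omega

theorem Cost.exists_implements {σ : Equiv.Perm (Bits n)} {k : ℕ} (h : Cost σ k) :
    ∃ C : Circuit n, Circuit.Implements C σ ∧ Circuit.size C ≤ k := by
  obtain ⟨C, hC, hk⟩ := h
  refine ⟨C, fun x => ?_, hk⟩
  rw [hC]
  ext y
  simp [ket, basisMap_apply, Pi.single_apply]

/-! ### Choice of the block size -/

/-- The two bounds place `2 ^ J` within constant factors of `log n`; `J = 0` covers small `n`. -/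
theorem exists_level (n : ℕ) :
    ∃ J : ℕ, (J = 0 ∨ 4 ^ 2 ^ (J + 1) ≤ n) ∧ n < 4 ^ 2 ^ (J + 2) := by
  classical
  have hex : ∃ J : ℕ, n < 4 ^ 2 ^ (J + 2) := by
    refine ⟨n, ?_⟩
    have h1 : n < 2 ^ (n + 2) := Nat.lt_two_pow_self.trans_le
      (Nat.pow_le_pow_right (by norm_num) (by omega))
    exact h1.trans (Nat.lt_pow_self (by norm_num))
  refine ⟨Nat.find hex, ?_, Nat.find_spec hex⟩
  rcases h : Nat.find hex with _ | m
  · exact Or.inl rfl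
  · exact Or.inr (not_lt.1 (Nat.find_min hex (m := m) (by omega)))

theorem logb_four_pow (m : ℕ) : Real.logb 2 ((4 ^ m : ℕ) : ℝ) = 2 * m := by
  have : ((4 ^ m : ℕ) : ℝ) = (2 : ℝ) ^ ((2 * m : ℕ) : ℝ) := by
    rw [Real.rpow_natCast, pow_mul]
    norm_num
  rw [this, Real.logb_rpow (by norm_num) (by norm_num)]
  push_cast
  ring

/-- A level `j` at which the block bound `s / 2 ^ j + 3 j` is at most the required one. -/
theorem exists_level_bound {s : ℕ} (hn : 2 ≤ n) (hs : 2 ≤ s) :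
    ∃ j : ℕ, (j = 0 ∨ 4 ^ 2 ^ (j + 1) ≤ n) ∧
      ((s / 2 ^ j + 3 * j : ℕ) : ℝ) ≤
        9 * ((s : ℝ) / Real.logb 2 n + Real.logb 2 (min (s : ℝ) (Real.logb 2 n))) := by
  obtain ⟨J, hJ, hJn⟩ := exists_level n
  set l := Real.logb 2 (n : ℝ) with hl
  have hn0 : (0 : ℝ) < n := by positivity
  have hs2 : (2 : ℝ) ≤ s := by exact_mod_cast hs
  have hl1 : 1 ≤ l := by
    rw [hl, Real.le_logb_iff_rpow_le (by norm_num) hn0]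
    simpa using (by exact_mod_cast hn : (2 : ℝ) ≤ n)
  have hlJ : (2 : ℝ) ^ J ≤ l := by
    rcases hJ with rfl | h
    · simpa using hl1
    · have h1 : Real.logb 2 ((4 ^ 2 ^ (J + 1) : ℕ) : ℝ) ≤ l :=
        Real.logb_le_logb_of_le (by norm_num) (by positivity) (by exact_mod_cast h)
      rw [logb_four_pow] at h1
      push_cast at h1
      have : (0 : ℝ) < 2 ^ J := by positivity
      rw [pow_succ] at h1
      linarith
  have hlJ' : l ≤ 8 * 2 ^ J := by
    have h1 : l ≤ Real.logb 2 ((4 ^ 2 ^ (J + 2) : ℕ) : ℝ) :=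
      Real.logb_le_logb_of_le (by norm_num) hn0 (by exact_mod_cast hJn.le)
    rw [logb_four_pow] at h1
    push_cast at h1
    rw [pow_add] at h1
    linarith
  -- The cap `Nat.log 2 s` keeps `2 ^ j ≤ s`, so that `j` is bounded by the logarithm of the
  -- minimum; when the cap is active, the quotient `s / 2 ^ j` is at most `1`.
  refine ⟨min J (Nat.log 2 s), ?_, ?_⟩
  · rcases Nat.eq_zero_or_pos (min J (Nat.log 2 s)) with h | h
    · exact Or.inl h
    · refine Or.inr ?_
      rcases hJ with h0 | h0
      · omega
      · exact le_trans (Nat.pow_le_pow_right (by norm_num)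
          (Nat.pow_le_pow_right (by norm_num) (by omega))) h0
  set j := min J (Nat.log 2 s) with hj
  have hmin : (0 : ℝ) < min (s : ℝ) l := lt_min (by linarith) (by linarith)
  have hjL : (j : ℝ) ≤ Real.logb 2 (min (s : ℝ) l) := by
    rw [Real.le_logb_iff_rpow_le (by norm_num) hmin, Real.rpow_natCast]
    refine le_min ?_ ?_
    · have h1 : 2 ^ j ≤ s := (Nat.pow_le_pow_right (by norm_num) (min_le_right _ _)).trans
        (Nat.pow_log_le_self 2 (by omega))
      exact_mod_cast h1
    · exact (pow_le_pow_right₀ (by norm_num) (min_le_left _ _)).trans hlJ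
  have hdiv : ((s / 2 ^ j : ℕ) : ℝ) ≤ 8 * (s / l) + 1 := by
    have hnn : 0 ≤ (s : ℝ) / l := by positivity
    rcases le_total J (Nat.log 2 s) with h | h
    · have hjJ : j = J := min_eq_left h
      have h1 : ((s / 2 ^ j : ℕ) : ℝ) ≤ (s : ℝ) / 2 ^ J := by
        rw [hjJ]
        exact_mod_cast (Nat.cast_div_le : ((s / 2 ^ J : ℕ) : ℝ) ≤ (s : ℝ) / ((2 ^ J : ℕ) : ℝ))
      have h2 : (s : ℝ) / 2 ^ J ≤ 8 * (s / l) := by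
        rw [← mul_div_assoc, div_le_div_iff₀ (by positivity) (by linarith)]
        have := mul_le_mul_of_nonneg_left hlJ' (by linarith : (0 : ℝ) ≤ s)
        linarith
      linarith
    · have hjJ : j = Nat.log 2 s := min_eq_right h
      have h1 : s / 2 ^ j < 2 := by
        rw [Nat.div_lt_iff_lt_mul (by positivity), hjJ, ← pow_succ']
        exact Nat.lt_pow_succ_log_self (by norm_num) s
      have h2 : ((s / 2 ^ j : ℕ) : ℝ) ≤ 1 := by exact_mod_cast Nat.lt_succ_iff.1 h1
      linarith
  have hj0 : (0 : ℝ) ≤ j := Nat.cast_nonneg j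
  -- This absorbs the additive `1` in `hdiv`, raising the factor `8` to `9`: the logarithm is at
  -- least `1` if `l ≥ 2`, and otherwise `s ≥ 2 ≥ l`.
  have hone : 1 ≤ (s : ℝ) / l + Real.logb 2 (min (s : ℝ) l) := by
    rcases le_total 2 l with h | h
    · have h1 : 1 ≤ Real.logb 2 (min (s : ℝ) l) := by
        rw [Real.le_logb_iff_rpow_le (by norm_num) hmin, Real.rpow_one]
        exact le_min hs2 h
      have : 0 ≤ (s : ℝ) / l := by positivity
      linarith
    · have h1 : 1 ≤ (s : ℝ) / l := by
        rw [one_le_div (by linarith)]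
        linarith
      linarith
  rw [Nat.cast_add, Nat.cast_mul, Nat.cast_ofNat]
  linarith

end QCircuit

theorem lemma8 :
    ∃ c : ℝ, 0 < c ∧ ∀ n : ℕ, 2 ≤ n → ∀ σ : Equiv.Perm (QCircuit.Bits n),
      ∃ C : QCircuit.Circuit n, QCircuit.Circuit.Implements C σ ∧
        (QCircuit.Circuit.size C : ℝ) ≤
          c * ((n : ℝ) * (QCircuit.permSize σ : ℝ) / Real.logb 2 (n : ℝ) +
            (n : ℝ) * Real.logb 2 (min (QCircuit.permSize σ : ℝ) (Real.logb 2 (n : ℝ)))) := by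
  refine ⟨562 * 9, by norm_num, fun n hn σ => ?_⟩
  have hl : 0 ≤ Real.logb 2 (n : ℝ) :=
    Real.logb_nonneg (by norm_num) (by exact_mod_cast (by omega : 1 ≤ n))
  rcases Nat.lt_or_ge (QCircuit.permSize σ) 2 with hs | hs
  · have h0 : QCircuit.permSize σ = 0 := by
      have := QCircuit.permSize_ne_one σ
      omega
    have hid : QCircuit.Cost σ 0 := by
      rw [QCircuit.eq_one_of_permSize_eq_zero h0]
      exact QCircuit.cost_id 0
    obtain ⟨C, hC, hk⟩ := hid.exists_implements
    refine ⟨C, hC, ?_⟩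
    rw [h0, Nat.le_zero.1 hk]
    simp [min_eq_left hl]
  · obtain ⟨j, hj, hb⟩ := QCircuit.exists_level_bound hn hs
    obtain ⟨C, hC, hk⟩ := (QCircuit.cost_perm (by omega) hj σ).exists_implements
    refine ⟨C, hC, ?_⟩
    have hk' : (QCircuit.Circuit.size C : ℝ) ≤
        562 * n * ((QCircuit.permSize σ / 2 ^ j + 3 * j : ℕ) : ℝ) := by
      exact_mod_cast hk
    refine hk'.trans ((mul_le_mul_of_nonneg_left hb (by positivity)).trans (le_of_eq ?_))
    ring
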